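/- Let $\mathcal R$ be an irreducible (reduced, crystallographic) root system in a finite-dimensional real vector space $V$, let $s:V\to V$ be a linear involution ($s^2=\mathrm{id}$, $s=\mathrm{id}$ allowed) with $s(\mathcal R)=\mathcal R$, and let $\mathcal Q\subseteq\mathcal R$ be parabolic, i.e. $\alpha,\beta\in\mathcal Q$, $\alpha+\beta\in\mathcal R$ imply $\alpha+\beta\in\mathcal Q$, and $\mathcal Q\cup(-\mathcal Q)=\mathcal R$. Set $\mathcal Q^n=\{\alpha\in\mathcal Q : -\alpha\notin\mathcal Q\}$. Assume that $(\mathcal Q,s)$ is nontrivial ($\mathcal Q\ne\mathcal R$) and fundamental (every root is a finite sum of elements of $\mathcal Q\cup s(\mathcal Q)$). For a Weyl chamber $C$ (a connected component of the set of regular elements of $V^*$) let $\mathcal R^{+}(C)$ and $\mathcal R^{-}(C)$ be the sets of roots that are positive, respectively negative, on $C$, let $\mathcal B(C)$ be the set of simple roots (the roots of $\mathcal R^{+}(C)$ that are not a sum of two roots of $\mathcal R^{+}(C)$), and let $\gamma_C$ be the lowest root: the root such that $\alpha-\gamma_C$ is a (possibly empty) sum of roots of $\mathcal R^{+}(C)$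 for every root $\alpha$. The chamber $C$ is admissible for $\mathcal Q$ if $\mathcal R^{+}(C)\subseteq\mathcal Q$. An admissible chamber $C$ is $S$-fit (respectively $V$-fit) for $(\mathcal Q,s)$ if $s(\alpha)\in\mathcal R^{+}(C)$ (respectively $s(\alpha)\in\mathcal R^{-}(C)$) for every $\alpha\in\mathcal B(C)\setminus\mathcal Q^n$ with $s(\alpha)\ne\pm\alpha$. For a root $\alpha$ let the $H$-index $\nu(\alpha)\in\{1,2,\dots\}\cup\{\infty\}$ be the minimal length $r$ of a sequence $(\beta_1,\dots,\beta_r)$ of elements of $\mathcal Q\cup s(\mathcal Q)$ such that all partial sums $\beta_1+\cdots+\beta_h$ $(1\le h\le r)$ are roots and $\beta_1+\cdots+\beta_r=\alpha$ ($\nu(\alpha)=\infty$ if there is no such sequence). Then, for every $V$-fit chamber $C_V$, every $S$-fit chamber $C_S$ and every admissible chamber $C$, $$\nu(\gamma_{C_V})\le\nu(\gamma_C)\le\nu(\gamma_{C_S}).$$ -/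

import Mathlib

/-! Parabolic sets of roots with an involution, fit Weyl chambers and `H`-indices.

The root system is Mathlib's `RootPairing` over `ℝ`: its roots are vectors of `M`, and `N` is the
dual space, in which the Weyl chambers live. -/

noncomputable section

namespace ParabolicRoots

variable {ι M N : Type*} [AddCommGroup M] [Module ℝ M] [AddCommGroup N] [Module ℝ N]

/-- The set of all roots, as vectors. -/
def roots (P : RootPairing ι ℝ M N) : Set M := Set.range P.root

/-- A set `Q` of roots is parabolic if it is closed and `Q ∪ (-Q)` is the set of all roots. -/
structure IsParabolic (P : RootPairing ι ℝ M N) (Q : Set M) : Prop where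
  subset_roots : Q ⊆ roots P
  closed : ∀ α ∈ Q, ∀ β ∈ Q, α + β ∈ roots P → α + β ∈ Q
  mem_or_neg_mem : ∀ α ∈ roots P, α ∈ Q ∨ -α ∈ Q

/-- The horocyclic part `Qⁿ` of a set of roots: the elements whose opposite is not in `Q`. -/
def horocyclicPart (Q : Set M) : Set M := {α | α ∈ Q ∧ -α ∉ Q}

/-- A set `A` of roots is generated by a set `E` of roots if `A` consists of the roots that are
finite sums of elements of `E`. -/
def IsGeneratedBy (P : RootPairing ι ℝ M N) (A E : Set M) : Prop :=
  E ⊆ roots P ∧ A = (AddSubmonoid.closure E : Set M) ∩ roots P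

section Chambers

/-- The regular elements: those on which no root vanishes. -/
def regularSet (P : RootPairing ι ℝ M N) : Set N :=
  {x | ∀ α ∈ roots P, P.toLinearMap α x ≠ 0}

/-- A Weyl chamber is a connected component of the set of regular elements. -/
def IsWeylChamber [TopologicalSpace N] (P : RootPairing ι ℝ M N) (C : Set N) : Prop :=
  ∃ x ∈ regularSet P, C = connectedComponentIn (regularSet P) x

/-- The roots that are positive on `C`. -/
def posRoots (P : RootPairing ι ℝ M N) (C : Set N) : Set M :=
  {α | α ∈ roots P ∧ ∀ x ∈ C, 0 < P.toLinearMap α x}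

/-- The roots that are negative on `C`. -/
def negRoots (P : RootPairing ι ℝ M N) (C : Set N) : Set M :=
  {α | α ∈ roots P ∧ ∀ x ∈ C, P.toLinearMap α x < 0}

/-- The simple roots: the positive roots that are not a sum of two positive roots. -/
def simpleRoots (P : RootPairing ι ℝ M N) (C : Set N) : Set M :=
  {α | α ∈ posRoots P C ∧ ¬ ∃ β ∈ posRoots P C, ∃ γ ∈ posRoots P C, α = β + γ}

/-- `C` is an admissible Weyl chamber for `Q`: all `C`-positive roots belong to `Q`. -/
def IsAdmissible [TopologicalSpace N] (P : RootPairing ι ℝ M N) (Q : Set M) (C : Set N) : Prop :=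
  IsWeylChamber P C ∧ posRoots P C ⊆ Q

/-- `γ` is the least root for the order defined by `C`: every root is obtained by adding to `γ` a
(possibly empty) sum of `C`-positive roots. -/
def IsLowestRoot (P : RootPairing ι ℝ M N) (C : Set N) (γ : M) : Prop :=
  γ ∈ roots P ∧ ∀ α ∈ roots P, α - γ ∈ AddSubmonoid.closure (posRoots P C)

/-- The lowest root `γ_C`. A root with the property `IsLowestRoot` exists (and is unique) whenever
the root system is irreducible and `C` is a Weyl chamber. -/
def lowestRoot (P : RootPairing ι ℝ M N) (C : Set N) : M :=
  Classical.epsilon (IsLowestRoot P C)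

end Chambers

section Involution

/-- An involution of the root system: a linear automorphism of order at most two of the space
spanned by the roots, mapping roots to roots. (It is automatically an isometry for the canonical
invariant inner product.) -/
structure IsRootInvolution (P : RootPairing ι ℝ M N) (s : M →ₗ[ℝ] M) : Prop where
  involutive : ∀ v, s (s v) = v
  map_roots : ∀ α ∈ roots P, s α ∈ roots P

/-- The complex roots: those that are neither real (`s α = α`) nor imaginary (`s α = -α`). -/
def complexRoots (P : RootPairing ι ℝ M N) (s : M →ₗ[ℝ] M) : Set M :=
  {α | α ∈ roots P ∧ s α ≠ α ∧ s α ≠ -α}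

/-- The admissible chamber `C` is `S`-fit for `(Q, s)`: complex simple roots outside `Qⁿ` have
`C`-positive conjugate. -/
def IsSFit [TopologicalSpace N] (P : RootPairing ι ℝ M N) (Q : Set M) (s : M →ₗ[ℝ] M)
    (C : Set N) : Prop :=
  IsAdmissible P Q C ∧
    ∀ α ∈ (simpleRoots P C ∩ complexRoots P s) \ horocyclicPart Q, s α ∈ posRoots P C

/-- The admissible chamber `C` is `V`-fit for `(Q, s)`: complex simple roots outside `Qⁿ` have
`C`-negative conjugate. -/
def IsVFit [TopologicalSpace N] (P : RootPairing ι ℝ M N) (Q : Set M) (s : M →ₗ[ℝ] M)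
    (C : Set N) : Prop :=
  IsAdmissible P Q C ∧
    ∀ α ∈ (simpleRoots P C ∩ complexRoots P s) \ horocyclicPart Q, s α ∈ negRoots P C

/-- `(Q, s)` is trivial if `Q` consists of all roots. -/
def IsTrivialPair (P : RootPairing ι ℝ M N) (Q : Set M) : Prop := Q = roots P

/-- `(Q, s)` is fundamental if `Q ∪ s(Q)` generates the root system. -/
def IsFundamental (P : RootPairing ι ℝ M N) (Q : Set M) (s : M →ₗ[ℝ] M) : Prop :=
  IsGeneratedBy P (roots P) (Q ∪ s '' Q)

/-- `(β₁, …, βᵣ)` is an `H`-sequence for `α`: all `βᵢ` are in `Q ∪ s(Q)`, all partial sums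
`β₁ + ⋯ + βₕ` with `1 ≤ h ≤ r` are roots, and the total sum is `α`. -/
structure IsHSequence (P : RootPairing ι ℝ M N) (Q : Set M) (s : M →ₗ[ℝ] M) (α : M)
    (l : List M) : Prop where
  mem : ∀ β ∈ l, β ∈ Q ∪ s '' Q
  partial_sum_mem : ∀ h : ℕ, 1 ≤ h → h ≤ l.length → (l.take h).sum ∈ roots P
  ne_nil : l ≠ []
  sum_eq : l.sum = α

/-- The `H`-index `ν(α)`: the minimal length of an `H`-sequence for `α`, and `∞` if there is
none. -/
def hIndex (P : RootPairing ι ℝ M N) (Q : Set M) (s : M →ₗ[ℝ] M) (α : M) : ℕ∞ :=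
  ⨅ (l : List M) (_ : IsHSequence P Q s α l), (l.length : ℕ∞)

end Involution

end ParabolicRoots

end

noncomputable section
namespace ParabolicRoots

/-! Put `T = Q ∩ s(Q)`. Adding elements of `T` to a root never raises the `H`-index: `Q` and `s(Q)`
are closed, so `Q ∪ s(Q)` is stable under adding elements of `T` as long as roots result, and a
Jacobi-type argument pushes the added root into one of the steps of an `H`-sequence
(`Reach.add_of_mem`, `hIndex_le_of_sub_mem_closure`).

For admissible `C` and `C'`, `γ_{C'} - γ_C` is a sum of `C`-positive roots and its opposite a sum of
`C'`-positive roots. All these roots are in `Q`, so the `C`-positive summands lie in `Q ∩ (-Q)`. If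
`C` is `S`-fit, such summands are in `T`; if `C` is `V`-fit, their opposites are. Hence passing from
`γ_{C_S}` to `γ_C`, or from `γ_C` to `γ_{C_V}`, only adds elements of `T`.

Existence of lowest roots is also proved here, from irreducibility
(`IsEuclideanRootSet.exists_lowest`). -/

/-- A finite symmetric set of nonzero vectors of a Euclidean space having the two properties of
root strings in a crystallographic root system on which the theory of positive roots relies. -/
structure IsEuclideanRootSet {M : Type*} [AddCommGroup M] [Module ℝ M]
    (B : LinearMap.BilinForm ℝ M) (R : Set M) : Prop where
  symm : ∀ x y, B x y = B y x
  pos : ∀ x, x ≠ 0 → 0 < B x x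
  finite : R.Finite
  zero_notMem : (0 : M) ∉ R
  neg_mem : ∀ α ∈ R, -α ∈ R
  sub_mem : ∀ α ∈ R, ∀ β ∈ R, 0 < B α β → α ≠ β → α - β ∈ R
  sub_mem_of_add_mem : ∀ α ∈ R, ∀ β ∈ R, B α β = 0 → α + β ∈ R → α - β ∈ R

theorem neg_mem_closure_neg {M : Type*} [AddCommGroup M] {E : Set M} {v : M} (hv : v ∈ AddSubmonoid.closure E) :
    -v ∈ AddSubmonoid.closure {x | -x ∈ E} := by
  induction hv using AddSubmonoid.closure_induction with
  | mem x hx => exact AddSubmonoid.subset_closure (by simpa using hx)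
  | zero => simp
  | add x y _ _ hx hy => rw [neg_add]; exact add_mem hx hy

/-! ### Sums of roots and closed sets of roots. -/

section Euclidean

variable {M : Type*} [AddCommGroup M] [Module ℝ M] {B : LinearMap.BilinForm ℝ M} {R : Set M}

theorem bilin_nonpos_of_mem_closure {u v : M} {E : Set M} (hv : v ∈ AddSubmonoid.closure E)
    (h : ∀ e ∈ E, B u e ≤ 0) : B u v ≤ 0 := by
  induction hv using AddSubmonoid.closure_induction with
  | mem x hx => exact h x hx
  | zero => simp
  | add x y _ _ hx hy => rw [map_add]; exact add_nonpos hx hy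

theorem bilin_eq_zero_of_mem_closure {u v : M} {E : Set M} (hv : v ∈ AddSubmonoid.closure E)
    (h : ∀ e ∈ E, B u e = 0) : B u v = 0 := by
  induction hv using AddSubmonoid.closure_induction with
  | mem x hx => exact h x hx
  | zero => simp
  | add x y _ _ hx hy => rw [map_add, hx, hy, add_zero]

theorem exists_cons_of_bilin_sum_pos {u : M} {m : Multiset M} (h : 0 < B u m.sum) :
    ∃ e m', m = e ::ₘ m' ∧ 0 < B u e := by
  by_contra! hcon
  refine h.not_ge (bilin_nonpos_of_mem_closure (E := {x | x ∈ m})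
    (AddSubmonoid.multiset_sum_mem _ _ fun x hx => AddSubmonoid.subset_closure hx) ?_)
  intro e he
  obtain ⟨m', rfl⟩ := Multiset.exists_cons_of_mem he
  exact hcon e m' rfl

namespace IsEuclideanRootSet

variable (hR : IsEuclideanRootSet B R)
include hR

theorem ne_zero {α : M} (hα : α ∈ R) : α ≠ 0 := fun h => hR.zero_notMem (h ▸ hα)

theorem add_mem_of_bilin_neg {α β : M} (hα : α ∈ R) (hβ : β ∈ R) (h : B α β < 0) (hne : α + β ≠ 0) :
    α + β ∈ R := by
  have := hR.sub_mem α hα (-β) (hR.neg_mem β hβ) (by simpa using h)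
    (fun h' => hne (by rw [h']; simp))
  simpa using this

/-- A root that is a sum of elements of a closed set of roots belongs to this set. -/
theorem mem_of_mem_closure {T : Set M} (hTR : T ⊆ R)
    (hT : ∀ α ∈ T, ∀ β ∈ T, α + β ∈ R → α + β ∈ T) {β : M} (hβ : β ∈ R)
    (h : β ∈ AddSubmonoid.closure T) : β ∈ T := by
  obtain ⟨m, hm, rfl⟩ := AddSubmonoid.exists_multiset_of_mem_closure h
  clear h
  induction hn : m.card generalizing m with
  | zero =>
    rw [Multiset.card_eq_zero] at hn
    subst hn
    exact absurd hβ (by simpa using hR.zero_notMem)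
  | succ n ih =>
    -- As `B β β > 0`, some summand `e` has `B β e > 0`, so `β - e` is zero or a shorter sum that is
    -- again a root.
    obtain ⟨e, m', rfl, he⟩ := exists_cons_of_bilin_sum_pos (hR.pos _ (hR.ne_zero hβ))
    have heT : e ∈ T := hm e (by simp)
    have hsum : (e ::ₘ m').sum - e = m'.sum := by simp
    by_cases hne : (e ::ₘ m').sum = e
    · rwa [hne]
    have hmem : m'.sum ∈ R := hsum ▸ hR.sub_mem _ hβ _ (hTR heT) he hne
    have := ih m' (fun y hy => hm y (by simp [hy])) hmem (by simpa using hn)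
    rw [Multiset.sum_cons] at hβ ⊢
    exact hT _ heT _ this hβ

/-- If two roots differ by a sum of elements of a closed set `T` of roots, then one is obtained
from the other by adding elements of `T` one by one, unless it is itself in `T`. -/
theorem induction_of_sub_mem_closure {T : Set M} (hTR : T ⊆ R)
    (hT : ∀ α ∈ T, ∀ β ∈ T, α + β ∈ R → α + β ∈ T) {p : M → Prop} (hpT : ∀ α ∈ T, p α)
    (hp : ∀ α ∈ R, ∀ β ∈ T, α + β ∈ R → p α → p (α + β)) {α β : M} (hα : α ∈ R) (hβ : β ∈ R)
    (h : β - α ∈ AddSubmonoid.closure T) (hpα : p α) : p β := by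
  obtain ⟨m, hm, hsum⟩ := AddSubmonoid.exists_multiset_of_mem_closure h
  clear h
  have hcl : ∀ m' : Multiset M, (∀ y ∈ m', y ∈ T) → m'.sum ∈ AddSubmonoid.closure T :=
    fun m' h' => AddSubmonoid.multiset_sum_mem _ _ fun y hy => AddSubmonoid.subset_closure (h' y hy)
  induction hn : m.card generalizing m α β with
  | zero =>
    rw [Multiset.card_eq_zero] at hn
    subst hn
    rw [Multiset.sum_zero, eq_comm, sub_eq_zero] at hsum
    rwa [hsum]
  | succ n ih =>
    by_cases hne : β = α
    · rwa [hne]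
    -- Some summand `e` has `B (β - α) e > 0`. Either `B β e > 0` and `e` is removed from `β`, or `B
    -- α e < 0` and `e` is added to `α`.
    have hpos : 0 < B (β - α) m.sum := by
      rw [hsum]; exact hR.pos _ (sub_ne_zero.2 hne)
    obtain ⟨e, m', rfl, he⟩ := exists_cons_of_bilin_sum_pos hpos
    have heT : e ∈ T := hm e (by simp)
    have hm' : ∀ y ∈ m', y ∈ T := fun y hy => hm y (by simp [hy])
    have hn' : m'.card = n := by simpa using hn
    rw [Multiset.sum_cons] at hsum
    rw [map_sub, LinearMap.sub_apply] at he
    rcases lt_or_ge 0 (B β e) with hβe | hβe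
    · by_cases hβe' : β = e
      · exact hpT _ (hβe' ▸ heT)
      have hmem := hR.sub_mem β hβ e (hTR heT) hβe hβe'
      have := ih hα hmem hpα m' hm' (by rw [sub_right_comm, ← hsum]; abel) hn'
      simpa using hp _ hmem e heT (by simpa using hβ) this
    · by_cases h0 : α + e = 0
      · refine hpT _ (hR.mem_of_mem_closure hTR hT hβ ?_)
        have : β = m'.sum := by
          rw [eq_neg_of_add_eq_zero_left h0] at hsum
          rw [sub_neg_eq_add, add_comm β] at hsum
          exact (add_left_cancel hsum).symm
        exact this ▸ hcl m' hm'
      · have hmem := hR.add_mem_of_bilin_neg hα (hTR heT) (by linarith) h0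
        exact ih hmem hβ (hp _ hα e heT hmem hpα) m' hm' (by rw [← sub_sub, ← hsum]; abel) hn'

/-- The Jacobi identity on the level of roots. -/
theorem add_mem_or_add_mem {σ β a : M} (hσ : σ ∈ R) (hβ : β ∈ R) (ha : a ∈ R) (hσβ : σ + β ∈ R)
    (h : σ + β + a ∈ R) : (σ + a = 0 ∨ σ + a ∈ R) ∨ (β + a = 0 ∨ β + a ∈ R) := by
  by_contra! hcon
  obtain ⟨⟨hσ0, hσa⟩, hβ0, hβa⟩ := hcon
  -- If both conclusions fail, `a` has nonnegative product with `σ` and `β`, while `σ + β + a` has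
  -- nonpositive product with both. Adding up contradicts `B (σ + β) (σ + β) > 0`.
  have h1 : 0 ≤ B σ a := le_of_not_gt fun h' => hσa (hR.add_mem_of_bilin_neg hσ ha h' hσ0)
  have h2 : 0 ≤ B β a := le_of_not_gt fun h' => hβa (hR.add_mem_of_bilin_neg hβ ha h' hβ0)
  have e1 : σ + β + a - σ = β + a := by abel
  have e2 : σ + β + a - β = σ + a := by abel
  have h3 : B (σ + β + a) σ ≤ 0 := le_of_not_gt fun h' =>
    hβa (e1 ▸ hR.sub_mem _ h σ hσ h' fun h'' => hβ0 (by rw [← e1, h'', sub_self]))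
  have h4 : B (σ + β + a) β ≤ 0 := le_of_not_gt fun h' =>
    hσa (e2 ▸ hR.sub_mem _ h β hβ h' fun h'' => hσ0 (by rw [← e2, h'', sub_self]))
  have h5 := hR.pos _ (hR.ne_zero hσβ)
  have := hR.symm σ β
  have := hR.symm σ a
  have := hR.symm β a
  have := (hR.pos a (hR.ne_zero ha)).le
  simp only [map_add, LinearMap.add_apply] at h3 h4 h5
  linarith

end IsEuclideanRootSet

/-! ### Positive systems and existence of the lowest root. -/

section Positive

variable (f : M →ₗ[ℝ] ℝ)

/-- The elements of `R` on which the linear form `f` is positive. -/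
def positiveSet (R : Set M) : Set M := {α | α ∈ R ∧ 0 < f α}

/-- The elements of `positiveSet f R` that are not a sum of two such elements. -/
def indecomposableSet (R : Set M) : Set M :=
  {α | α ∈ positiveSet f R ∧ ¬ ∃ β ∈ positiveSet f R, ∃ γ ∈ positiveSet f R, α = β + γ}

variable {f}

/-- A counterexample with `f` minimal must be decomposable; finiteness of `R` replaces an integral
height. -/
theorem positive_induction (hfin : R.Finite) {p : M → Prop}
    (hind : ∀ α ∈ indecomposableSet f R, p α)
    (hadd : ∀ α ∈ positiveSet f R, ∀ β ∈ positiveSet f R, α + β ∈ R →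
      (∀ γ ∈ positiveSet f R, f γ < f (α + β) → p γ) → p (α + β))
    {α : M} (hα : α ∈ positiveSet f R) : p α := by
  by_contra hcon
  obtain ⟨β, ⟨hβ, hpβ⟩, hmin⟩ := Set.exists_min_image {β | β ∈ positiveSet f R ∧ ¬ p β} f
    (hfin.subset fun x hx => hx.1.1) ⟨α, hα, hcon⟩
  by_cases h : β ∈ indecomposableSet f R
  · exact hpβ (hind β h)
  · simp only [indecomposableSet, Set.mem_ofPred_eq, not_and, not_not] at h
    obtain ⟨b, hb, c, hc, rfl⟩ := h hβ
    exact hpβ (hadd b hb c hc hβ.1 fun γ hγ hlt => by_contra fun h' => (hmin γ ⟨hγ, h'⟩).not_gt hlt)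

theorem positiveSet_subset_closure (hfin : R.Finite) :
    positiveSet f R ⊆ AddSubmonoid.closure (indecomposableSet f R) := by
  intro α hα
  refine positive_induction hfin (fun α hα => AddSubmonoid.subset_closure hα) ?_ hα
  intro b hb c hc _ ih
  rw [map_add] at ih
  exact add_mem (ih b hb (by linarith [hc.2])) (ih c hc (by linarith [hb.2]))

theorem IsEuclideanRootSet.bilin_indecomposable_nonpos (hR : IsEuclideanRootSet B R)
    (hf : ∀ α ∈ R, f α ≠ 0) {α β : M} (hα : α ∈ indecomposableSet f R)
    (hβ : β ∈ indecomposableSet f R) (hne : α ≠ β) : B α β ≤ 0 := by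
  by_contra! h
  have hmem := hR.sub_mem α hα.1.1 β hβ.1.1 h hne
  rcases (hf _ hmem).lt_or_gt with h' | h'
  · refine hβ.2 ⟨α, hα.1, β - α, ⟨by simpa using hR.neg_mem _ hmem, ?_⟩, by abel⟩
    rw [map_sub] at h' ⊢; linarith
  · exact hα.2 ⟨β, hβ.1, α - β, ⟨hmem, h'⟩, by abel⟩

/-- If the indecomposable elements split into two orthogonal sets, each positive element is
supported on one of them. -/
theorem IsEuclideanRootSet.mem_closure_or_mem_closure (hR : IsEuclideanRootSet B R)
    (hf : ∀ α ∈ R, f α ≠ 0) {T T' : Set M} (hunion : indecomposableSet f R ⊆ T ∪ T')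
    (horth : ∀ t ∈ T, ∀ t' ∈ T', B t t' = 0) {α : M} (hα : α ∈ positiveSet f R) :
    α ∈ AddSubmonoid.closure T ∨ α ∈ AddSubmonoid.closure T' := by
  have horth' : ∀ x ∈ AddSubmonoid.closure T, ∀ y ∈ AddSubmonoid.closure T', B x y = 0 := by
    intro x hx y hy
    refine bilin_eq_zero_of_mem_closure hy fun t' ht' => ?_
    rw [hR.symm]
    exact bilin_eq_zero_of_mem_closure hx fun t ht => by rw [hR.symm]; exact horth t ht t' ht'
  refine positive_induction hR.finite (f := f)
    (fun α hα => (hunion hα).imp (AddSubmonoid.subset_closure ·) (AddSubmonoid.subset_closure ·))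
    ?_ hα
  have key : ∀ b ∈ positiveSet f R, ∀ c ∈ positiveSet f R, b + c ∈ R →
      (∀ γ ∈ positiveSet f R, f γ < f (b + c) →
        γ ∈ AddSubmonoid.closure T ∨ γ ∈ AddSubmonoid.closure T') →
      b ∈ AddSubmonoid.closure T → c ∈ AddSubmonoid.closure T' → False := by
    intro b hb c hc hbc ih hbT hcT
    have h0 := horth' b hbT c hcT
    have hpb := hR.pos b (hR.ne_zero hb.1)
    have hpc := hR.pos c (hR.ne_zero hc.1)
    -- One of `±(b - c)` is positive with smaller `f`, hence supported on `T` or on `T'`. Pairing it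
    -- with whichever of `b`, `c` lies on the other side gives zero norm.
    have hmem := hR.sub_mem_of_add_mem b hb.1 c hc.1 h0 hbc
    have hb2 := hb.2
    have hc2 := hc.2
    rcases (hf _ hmem).lt_or_gt with h' | h'
    · have hmem' : c - b ∈ positiveSet f R :=
        ⟨by simpa using hR.neg_mem _ hmem, by rw [map_sub] at h' ⊢; linarith⟩
      rcases ih _ hmem' (by rw [map_sub, map_add]; linarith) with h | h
      · have := horth' _ h _ hcT
        rw [map_sub, LinearMap.sub_apply, h0] at this
        linarith
      · have := horth' _ hbT _ h
        rw [map_sub, h0] at this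
        linarith
    · rcases ih _ ⟨hmem, h'⟩ (by rw [map_sub, map_add]; linarith) with h | h
      · have := horth' _ h _ hcT
        rw [map_sub, LinearMap.sub_apply, h0] at this
        linarith
      · have := horth' _ hbT _ h
        rw [map_sub, h0] at this
        linarith
  intro b hb c hc hbc ih
  have hb2 := hb.2
  have hc2 := hc.2
  rcases ih b hb (by rw [map_add]; linarith), ih c hc (by rw [map_add]; linarith) with
    ⟨h1 | h1, h2 | h2⟩
  · exact .inl (add_mem h1 h2)
  · exact (key b hb c hc hbc ih h1 h2).elim
  · exact (key c hc b hb (add_comm b c ▸ hbc) (by rwa [add_comm]) h2 h1).elim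
  · exact .inr (add_mem h1 h2)

/-- In an irreducible system the root minimizing `f` is the least root. -/
theorem IsEuclideanRootSet.exists_lowest (hR : IsEuclideanRootSet B R)
    (hne : R.Nonempty) (hf : ∀ α ∈ R, f α ≠ 0)
    (hirr : ∀ T ⊆ R, T.Nonempty →
      (∀ α ∈ R, α ∈ Submodule.span ℝ T ∨ ∀ t ∈ T, B α t = 0) → Submodule.span ℝ T = ⊤) :
    ∃ γ ∈ R, ∀ α ∈ R, α - γ ∈ AddSubmonoid.closure (positiveSet f R) := by
  obtain ⟨γ, hγ, hmin⟩ := Set.exists_min_image R f hR.finite hne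
  refine ⟨γ, hγ, ?_⟩
  have hγneg : f γ < 0 := by
    have := hmin _ (hR.neg_mem γ hγ)
    rw [map_neg] at this
    exact lt_of_le_of_ne (by linarith) (hf γ hγ)
  have hnegγ : -γ ∈ positiveSet f R := ⟨hR.neg_mem γ hγ, by rw [map_neg]; linarith⟩
  have hanti : ∀ a ∈ positiveSet f R, B γ a ≤ 0 := by
    intro a ha
    by_contra! h
    have := hmin _ (hR.sub_mem γ hγ a ha.1 h fun h' => by have := ha.2; rw [← h'] at this; linarith)
    rw [map_sub] at this
    linarith [ha.2]
  have hcl : positiveSet f R ⊆ AddSubmonoid.closure (indecomposableSet f R) :=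
    positiveSet_subset_closure hR.finite
  -- `T` is the support of the highest root `-γ`: the simple roots occurring in some expression of
  -- it.
  set T : Set M :=
    {a | a ∈ indecomposableSet f R ∧ -γ - a ∈ AddSubmonoid.closure (indecomposableSet f R)} with hT
  set T' : Set M := indecomposableSet f R \ T with hT'
  have horth : ∀ t ∈ T, ∀ a ∈ T', B t a = 0 := by
    intro t ht a ha
    have hle : ∀ u ∈ T, B a u ≤ 0 := fun u hu =>
      hR.bilin_indecomposable_nonpos hf ha.1 hu.1 fun h => ha.2 (h ▸ hu)
    -- Every simple summand of such a `v` lies in `T`, so `B a v ≤ 0`. For `v = -γ - t`, together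
    -- with `B a t ≤ 0` and `B a γ ≤ 0`, this forces `B a t = 0`.
    have aux : ∀ v ∈ AddSubmonoid.closure (indecomposableSet f R),
        -γ - v ∈ AddSubmonoid.closure (indecomposableSet f R) → B a v ≤ 0 := by
      intro v hv
      induction hv using AddSubmonoid.closure_induction with
      | mem x hx => exact fun h => hle x ⟨hx, h⟩
      | zero => simp
      | add x y hx hy ihx ihy =>
        intro h
        rw [map_add]
        refine add_nonpos (ihx ?_) (ihy ?_)
        · have := add_mem h hy
          rwa [show -γ - (x + y) + y = -γ - x by abel] at this
        · have := add_mem h hx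
          rwa [show -γ - (x + y) + x = -γ - y by abel] at this
    have h1 := aux _ ht.2 (by simpa using AddSubmonoid.subset_closure ht.1)
    have h2 := hle t ht
    have h3 := hanti a ha.1.1
    rw [hR.symm] at h3
    rw [map_sub, map_neg] at h1
    rw [hR.symm]
    linarith
  have hTne : T.Nonempty := by
    obtain ⟨m, hm, hsum⟩ := AddSubmonoid.exists_multiset_of_mem_closure (hcl hnegγ)
    obtain ⟨e, m', rfl, -⟩ := exists_cons_of_bilin_sum_pos (B := B) (u := -γ) (m := m)
      (by rw [hsum]; exact hR.pos _ (hR.ne_zero hnegγ.1))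
    refine ⟨e, hm e (by simp), ?_⟩
    rw [← hsum, Multiset.sum_cons, add_sub_cancel_left]
    exact AddSubmonoid.multiset_sum_mem _ _ fun y hy =>
      AddSubmonoid.subset_closure (hm y (by simp [hy]))
  have hspan : Submodule.span ℝ T = ⊤ := by
    refine hirr T (fun t ht => ht.1.1.1) hTne ?_
    have hpos : ∀ α ∈ positiveSet f R, α ∈ Submodule.span ℝ T ∨ ∀ t ∈ T, B α t = 0 := by
      intro α hα
      refine (hR.mem_closure_or_mem_closure hf (T := T) (T' := T') (fun x hx => ?_) horth hα).imp
        (fun h => Submodule.closure_subset_span h) fun h t ht => ?_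
      · by_cases h : x ∈ T
        exacts [.inl h, .inr ⟨hx, h⟩]
      · rw [hR.symm]
        exact bilin_eq_zero_of_mem_closure h fun a ha => horth t ht a ha
    intro α hα
    rcases (hf α hα).lt_or_gt with h | h
    · have := hpos (-α) ⟨hR.neg_mem α hα, by rw [map_neg]; linarith⟩
      simpa using this
    · exact hpos α ⟨hα, h⟩
  by_contra! hcon
  obtain ⟨β, ⟨hβ, hβS⟩, hβmin⟩ := Set.exists_min_image
    {α | α ∈ R ∧ α - γ ∉ AddSubmonoid.closure (positiveSet f R)} f
    (hR.finite.subset fun x hx => hx.1) hcon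
  have hβanti : ∀ a ∈ positiveSet f R, B β a ≤ 0 := by
    intro a ha
    by_contra! h
    have hane : β ≠ a := by
      rintro rfl
      apply hβS
      rw [sub_eq_add_neg]
      exact add_mem (AddSubmonoid.subset_closure ha) (AddSubmonoid.subset_closure hnegγ)
    have hmem := hR.sub_mem β hβ a ha.1 h hane
    have : β - a - γ ∈ AddSubmonoid.closure (positiveSet f R) := by
      by_contra h'
      have := hβmin _ ⟨hmem, h'⟩
      rw [map_sub] at this
      linarith [ha.2]
    apply hβS
    have := add_mem this (AddSubmonoid.subset_closure ha)
    rwa [show β - a - γ + a = β - γ by abel] at this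
  have hβγ : B β γ ≤ 0 := by
    by_contra! h
    have hne' : β ≠ γ := by
      rintro rfl
      exact hβS (by simp)
    have hmem := hR.sub_mem β hβ γ hγ h hne'
    refine hβS (AddSubmonoid.subset_closure ⟨hmem, ?_⟩)
    have := hmin β hβ
    exact lt_of_le_of_ne (by rw [map_sub]; linarith) (hf _ hmem).symm
  -- `B β (-γ) ≥ 0`, but `-γ` is `t` plus simple roots, all with nonpositive product with `β`. So
  -- `β` is orthogonal to `T`, which spans.
  have hβT : ∀ t ∈ T, B β t = 0 := by
    intro t ht
    have h1 := hβanti t ht.1.1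
    have h2 := bilin_nonpos_of_mem_closure ht.2 fun e he => hβanti e he.1
    rw [map_sub, map_neg] at h2
    linarith
  have hker : Submodule.span ℝ T ≤ LinearMap.ker (B β) := Submodule.span_le.2 hβT
  rw [hspan] at hker
  exact (hR.pos β (hR.ne_zero hβ)).ne' (hker (Submodule.mem_top (x := β)))

end Positive

end Euclidean

end ParabolicRoots
end

noncomputable section
namespace ParabolicRoots

/-! ### `H`-sequences built step by step. -/

section HIndex

/-- `Reach E R n α`: the vector `α` is reached in `n` steps, adding elements of `E`
without leaving `R`. -/
inductive Reach {M : Type*} [AddCommGroup M] (E R : Set M) : ℕ → M → Prop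
  | one {α : M} : α ∈ E → α ∈ R → Reach E R 1 α
  | step {n : ℕ} {α β : M} : Reach E R n α → β ∈ E → α + β ∈ R → Reach E R (n + 1) (α + β)

theorem Reach.mem {M : Type*} [AddCommGroup M] {E R : Set M} {n : ℕ} {α : M}
    (h : Reach E R n α) : α ∈ R := by
  cases h <;> assumption

variable {ι M N : Type*} [AddCommGroup M] [Module ℝ M] [AddCommGroup N] [Module ℝ N]
  {P : RootPairing ι ℝ M N} {Q : Set M} {s : M →ₗ[ℝ] M}

theorem IsHSequence.reach {α : M} {l : List M} (h : IsHSequence P Q s α l) :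
    Reach (Q ∪ s '' Q) (roots P) l.length α := by
  induction l using List.reverseRecOn generalizing α with
  | nil => exact absurd rfl h.ne_nil
  | append_singleton l β ih =>
    obtain ⟨hmem, hpar, -, rfl⟩ := h
    have hlast : (l ++ [β]).sum ∈ roots P := by
      simpa using hpar (l ++ [β]).length (by simp) le_rfl
    rcases eq_or_ne l [] with rfl | hl
    · simpa using Reach.one (hmem β (by simp)) (by simpa using hlast)
    · have hseq : IsHSequence P Q s l.sum l := by
        refine ⟨fun b hb => hmem b (by simp [hb]), fun h h1 h2 => ?_, hl, rfl⟩
        have := hpar h h1 (by simp; lia)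
        rwa [List.take_append_of_le_length h2] at this
      rw [List.sum_append, List.sum_singleton] at hlast ⊢
      rw [List.length_append, List.length_singleton]
      exact (ih hseq).step (hmem β (by simp)) hlast

theorem Reach.exists_isHSequence {n : ℕ} {α : M} (h : Reach (Q ∪ s '' Q) (roots P) n α) :
    ∃ l, IsHSequence P Q s α l ∧ l.length = n := by
  induction h with
  | @one α hE hR =>
    refine ⟨[α], ⟨by simpa using hE, fun h h1 h2 => ?_, by simp, by simp⟩, rfl⟩
    obtain rfl : h = 1 := le_antisymm h2 h1
    simpa using hR
  | @step n α β _ hβ hR ih =>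
    obtain ⟨l, hl, rfl⟩ := ih
    refine ⟨l ++ [β], ⟨fun b hb => ?_, fun h h1 h2 => ?_, by simp, by simp [hl.sum_eq]⟩, by simp⟩
    · rcases List.mem_append.1 hb with hb | hb
      · exact hl.mem b hb
      · rw [List.mem_singleton.1 hb]; exact hβ
    · rcases lt_or_ge l.length h with h3 | h3
      · rw [List.take_of_length_le (by simpa using h3), List.sum_append, hl.sum_eq]
        simpa using hR
      · rw [List.take_append_of_le_length h3]
        exact hl.partial_sum_mem h h1 h3

theorem hIndex_le_of_forall_reach {α β : M}
    (h : ∀ n, Reach (Q ∪ s '' Q) (roots P) n α →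
      ∃ m ≤ n, Reach (Q ∪ s '' Q) (roots P) m β) :
    hIndex P Q s β ≤ hIndex P Q s α := by
  refine le_iInf₂ fun l hl => ?_
  obtain ⟨m, hm, hreach⟩ := h _ hl.reach
  obtain ⟨l', hl', rfl⟩ := hreach.exists_isHSequence
  exact iInf₂_le_of_le l' hl' (by exact_mod_cast hm)

/-- Adding an element of `T` does not increase the number of steps, if `E` is stable under
adding elements of `T`. -/
theorem Reach.add_of_mem {B : LinearMap.BilinForm ℝ M} {E T R : Set M}
    (hR : IsEuclideanRootSet B R) (hER : E ⊆ R) (hTR : T ⊆ R)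
    (hE : ∀ β ∈ E, ∀ a ∈ T, β + a ∈ R → β + a ∈ E) {n : ℕ} {α a : M} (h : Reach E R n α)
    (ha : a ∈ T) (hαa : α + a ∈ R) : ∃ m ≤ n, Reach E R m (α + a) := by
  induction h with
  | one hαE _ => exact ⟨1, le_rfl, .one (hE _ hαE a ha hαa) hαa⟩
  | @step n σ β hσ hβ hσβ ih =>
    -- Either `a` is absorbed into the earlier part `σ`, or into the last step `β`, where `β + a`
    -- stays in `E`. A zero sum shortens the sequence.
    rcases hR.add_mem_or_add_mem hσ.mem (hER hβ) (hTR ha) hσβ hαa with (h | h) | (h | h)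
    · rw [show σ + β + a = β by rw [add_right_comm, h, zero_add]]
      exact ⟨1, by lia, .one hβ (hER hβ)⟩
    · obtain ⟨m, hm, hr⟩ := ih h
      rw [add_right_comm] at hαa ⊢
      exact ⟨m + 1, by lia, hr.step hβ hαa⟩
    · rw [add_assoc, h, add_zero]
      exact ⟨n, by lia, hσ⟩
    · rw [add_assoc] at hαa ⊢
      exact ⟨n + 1, le_rfl, hσ.step (hE β hβ a ha h) hαa⟩

end HIndex

/-! ### Parabolic sets and monotonicity of the `H`-index. -/

section Parabolic

variable {ι M N : Type*} [AddCommGroup M] [Module ℝ M] [AddCommGroup N] [Module ℝ N]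
  {P : RootPairing ι ℝ M N} {Q : Set M} {s : M →ₗ[ℝ] M} {B : LinearMap.BilinForm ℝ M}

theorem IsParabolic.image (hQ : IsParabolic P Q) (hs : IsRootInvolution P s) :
    IsParabolic P (s '' Q) where
  subset_roots := by
    rintro _ ⟨α, hα, rfl⟩
    exact hs.map_roots α (hQ.subset_roots hα)
  closed := by
    rintro _ ⟨α, hα, rfl⟩ _ ⟨β, hβ, rfl⟩ h
    rw [← map_add] at h ⊢
    refine ⟨_, hQ.closed α hα β hβ ?_, rfl⟩
    simpa only [hs.involutive] using hs.map_roots _ h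
  mem_or_neg_mem α hα :=
    (hQ.mem_or_neg_mem _ (hs.map_roots α hα)).imp (fun h => ⟨_, h, hs.involutive α⟩)
      fun h => ⟨_, h, by rw [map_neg, hs.involutive]⟩

theorem IsParabolic.mem_of_mem_closure (hR : IsEuclideanRootSet B (roots P))
    (hQ : IsParabolic P Q) {α : M} (hα : α ∈ roots P) (h : α ∈ AddSubmonoid.closure Q) : α ∈ Q :=
  hR.mem_of_mem_closure hQ.subset_roots hQ.closed hα h

/-- The difference is added root by root within the root system. When this path breaks down, the
target lies in `Q ∩ s(Q)` and has index 1, which is no larger. -/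
theorem hIndex_le_of_sub_mem_closure (hR : IsEuclideanRootSet B (roots P))
    (hQ : IsParabolic P Q) (hs : IsRootInvolution P s) {α β : M} (hα : α ∈ roots P)
    (hβ : β ∈ roots P) (h : β - α ∈ AddSubmonoid.closure (Q ∩ s '' Q)) :
    hIndex P Q s β ≤ hIndex P Q s α := by
  have hQ' := hQ.image hs
  refine hIndex_le_of_forall_reach fun n hn => ?_
  have hn1 : 1 ≤ n := by cases hn <;> lia
  have hTR : Q ∩ s '' Q ⊆ roots P := fun x hx => hQ.subset_roots hx.1
  refine hR.induction_of_sub_mem_closure (T := Q ∩ s '' Q)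
    (p := fun β => ∃ m ≤ n, Reach (Q ∪ s '' Q) (roots P) m β) hTR
    (fun α hα β hβ h => ⟨hQ.closed α hα.1 β hβ.1 h, hQ'.closed α hα.2 β hβ.2 h⟩)
    (fun α hα => ⟨1, hn1, .one (.inl hα.1) (hTR hα)⟩) ?_ hα hβ h ⟨n, le_rfl, hn⟩
  rintro α - a ha hαa ⟨m, hm, hr⟩
  obtain ⟨m', hm', hr'⟩ := hr.add_of_mem hR (Set.union_subset hQ.subset_roots hQ'.subset_roots) hTR
    (fun β hβ a ha h => hβ.imp (fun hβ => hQ.closed β hβ a ha.1 h)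
      fun hβ => hQ'.closed β hβ a ha.2 h) ha hαa
  exact ⟨m', hm'.trans hm, hr'⟩

/-- If `v` is a sum of elements of `A ⊆ Q` and `-v` a sum of elements of `Q`, the summands of `v`
are in `Q ∩ (-Q)`. -/
theorem mem_closure_inter_neg (hR : IsEuclideanRootSet B (roots P)) (hQ : IsParabolic P Q)
    {A : Set M} (hA : A ⊆ Q) {v : M} (hv : v ∈ AddSubmonoid.closure A)
    (hv' : -v ∈ AddSubmonoid.closure Q) : v ∈ AddSubmonoid.closure {a | a ∈ A ∧ -a ∈ Q} := by
  induction hv using AddSubmonoid.closure_induction with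
  | mem x hx =>
    exact AddSubmonoid.subset_closure
      ⟨hx, hQ.mem_of_mem_closure hR (hR.neg_mem x (hQ.subset_roots (hA hx))) hv'⟩
  | zero => exact zero_mem _
  | add x y hx hy ihx ihy =>
    -- `-x = -(x + y) + y` is again a sum of elements of `Q`; likewise for `y`.
    refine add_mem (ihx ?_) (ihy ?_)
    · have := add_mem hv' (AddSubmonoid.closure_mono hA hy)
      rwa [show -(x + y) + y = -x by abel] at this
    · have := add_mem hv' (AddSubmonoid.closure_mono hA hx)
      rwa [show -(x + y) + x = -y by abel] at this

/-- Such a root is a sum of simple roots all lying in `Q ∩ (-Q)`, and `Q` contains every root that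
is a sum of its elements. The map `t` will be `s` or `-s`. -/
theorem map_mem_of_forall_simpleRoots (hR : IsEuclideanRootSet B (roots P))
    (hQ : IsParabolic P Q) {C : Set N} {f : M →ₗ[ℝ] ℝ} (hC : posRoots P C = positiveSet f (roots P))
    (hCQ : posRoots P C ⊆ Q) {t : M →ₗ[ℝ] M} (ht : ∀ α ∈ roots P, t α ∈ roots P)
    (h : ∀ α ∈ simpleRoots P C, -α ∈ Q → t α ∈ Q) {α : M} (hα : α ∈ posRoots P C)
    (hα' : -α ∈ Q) : t α ∈ Q := by
  have hsimple : simpleRoots P C = indecomposableSet f (roots P) := by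
    simp only [simpleRoots, indecomposableSet, hC]
  have hsub : simpleRoots P C ⊆ Q := fun x hx => hCQ hx.1
  have hcl : α ∈ AddSubmonoid.closure (simpleRoots P C) := by
    rw [hsimple]; exact positiveSet_subset_closure hR.finite (hC ▸ hα)
  have hcl' := mem_closure_inter_neg hR hQ hsub hcl (AddSubmonoid.subset_closure hα')
  refine hQ.mem_of_mem_closure hR (ht α hα.1) ?_
  clear hcl hα hα'
  induction hcl' using AddSubmonoid.closure_induction with
  | mem x hx => exact AddSubmonoid.subset_closure (h x hx.1 hx.2)
  | zero => simp
  | add x y _ _ hx hy => rw [map_add]; exact add_mem hx hy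

end Parabolic

/-! ### The invariant form, lowest roots and chambers of a root system. -/

section RootSystem

variable {ι M N : Type*} [Finite ι] [AddCommGroup M] [Module ℝ M] [AddCommGroup N] [Module ℝ N]
  (P : RootPairing ι ℝ M N)

theorem exists_isEuclideanRootSet [P.IsRootSystem] [P.IsCrystallographic] :
    ∃ B : LinearMap.BilinForm ℝ M, IsEuclideanRootSet B (roots P) ∧
      ∀ i j, B (P.root i) (P.root j) = 0 ↔ P.pairing i j = 0 := by
  have := Fintype.ofFinite ι
  have hsymm : ∀ x y, P.RootForm x y = P.RootForm y x := fun x y => by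
    simp [P.rootForm_apply_apply, mul_comm]
  have hpos : ∀ x, x ≠ 0 → 0 < P.RootForm x x := by
    intro x hx
    obtain ⟨i, hi⟩ := not_forall.1 (mt (P.eq_zero_iff_forall_coroot'_eq_zero).2 hx)
    rw [P.rootForm_apply_apply]
    exact Finset.sum_pos' (fun i _ => mul_self_nonneg _)
      ⟨i, Finset.mem_univ i, mul_self_pos.2 hi⟩
  have htwo : ∀ i j, 2 * P.RootForm (P.root i) (P.root j) =
      P.pairing i j * P.RootForm (P.root j) (P.root j) :=
    P.toInvariantForm.two_mul_apply_root_root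
  have hrr : ∀ i, 0 < P.RootForm (P.root i) (P.root i) := fun i => hpos _ (P.ne_zero i)
  have hzero : ∀ i j, P.RootForm (P.root i) (P.root j) = 0 ↔ P.pairing i j = 0 := fun i j =>
    P.toInvariantForm.apply_root_root_zero_iff i j
  refine ⟨P.RootForm, ⟨hsymm, hpos, Set.finite_range _, ?_, ?_, ?_, ?_⟩, hzero⟩
  · rintro ⟨i, hi⟩
    exact P.ne_zero i hi
  · rintro _ ⟨i, rfl⟩
    exact ⟨P.reflectionPerm i i, by simp⟩
  · rintro _ ⟨i, rfl⟩ _ ⟨j, rfl⟩ h hne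
    refine P.root_sub_root_mem_of_pairingIn_pos ?_ fun h' => hne (by rw [h'])
    have : 0 < P.pairing i j := by
      by_contra! h'
      nlinarith [htwo i j, hrr j, mul_nonneg (neg_nonneg.2 h') (hrr j).le]
    rw [← P.algebraMap_pairingIn ℤ] at this
    simpa using this
  · rintro _ ⟨i, rfl⟩ _ ⟨j, rfl⟩ h ⟨k, hk⟩
    -- The reflection in the second root fixes the first, which is orthogonal to it, so it turns
    -- their sum into their difference.
    refine ⟨P.reflectionPerm j k, ?_⟩
    have hij := (hzero i j).1 h
    rw [P.root_reflectionPerm, hk, map_add, P.reflection_apply_self, P.reflection_apply_root, hij]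
    simp [sub_eq_add_neg]

theorem isLowestRoot_lowestRoot [P.IsRootSystem] [P.IsCrystallographic] [P.IsIrreducible]
    {C : Set N} {x : N} (hx : x ∈ regularSet P)
    (hC : posRoots P C = positiveSet (P.toLinearMap.flip x) (roots P)) :
    IsLowestRoot P C (lowestRoot P C) := by
  refine Classical.epsilon_spec (p := IsLowestRoot P C) ?_
  obtain ⟨B, hR, hB⟩ := exists_isEuclideanRootSet P
  have := RootPairing.IsIrreducible.nontrivial P
  have hne : (roots P).Nonempty := by
    by_contra! h
    have htop := RootPairing.IsRootSystem.span_root_eq_top (P := P)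
    rw [show Set.range P.root = ∅ from h, Submodule.span_empty] at htop
    exact bot_ne_top htop
  simp only [IsLowestRoot, hC]
  refine hR.exists_lowest hne hx ?_
  intro T hTR hTne h
  obtain ⟨I, rfl⟩ := Set.subset_range_iff_exists_image_eq.1 hTR
  refine P.span_root_image_eq_top_of_forall_orthogonal I hTne.of_image fun j hj i hi => ?_
  have := ((h _ ⟨j, rfl⟩).resolve_left hj) _ ⟨i, hi, rfl⟩
  exact ⟨(hB j i).1 this, (hB i j).1 (by rw [hR.symm]; exact this)⟩

/-- A root cannot change sign on a connected set of regular elements, so one point of the chamber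
determines the positive roots. -/
theorem IsWeylChamber.exists_regular [P.IsRootSystem] [TopologicalSpace N]
    [IsTopologicalAddGroup N] [ContinuousSMul ℝ N] [T2Space N] {C : Set N}
    (hC : IsWeylChamber P C) :
    ∃ x ∈ regularSet P, posRoots P C = positiveSet (P.toLinearMap.flip x) (roots P) := by
  obtain ⟨x, hx, rfl⟩ := hC
  refine ⟨x, hx, ?_⟩
  have hxC := mem_connectedComponentIn hx
  have hfin : FiniteDimensional ℝ N := by
    refine ⟨?_⟩
    rw [← RootPairing.IsRootSystem.span_coroot_eq_top (P := P)]
    exact Submodule.fg_span (Set.finite_range _)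
  ext α
  refine ⟨fun h => ⟨h.1, h.2 x hxC⟩, fun h => ⟨h.1, fun y hy => ?_⟩⟩
  by_contra! hle
  have hcont : Continuous (P.toLinearMap α) := LinearMap.continuous_of_finiteDimensional _
  obtain ⟨z, hz, hz0⟩ := isPreconnected_connectedComponentIn.intermediate_value hy hxC
    hcont.continuousOn ⟨hle, h.2.le⟩
  exact connectedComponentIn_subset _ _ hz α h.1 hz0

end RootSystem

/-! ### Fit chambers and comparison of lowest roots. -/

section Fit

variable {ι M N : Type*} [AddCommGroup M] [Module ℝ M] [AddCommGroup N] [Module ℝ N]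
  [TopologicalSpace N] {P : RootPairing ι ℝ M N} {Q : Set M} {s : M →ₗ[ℝ] M}
  {B : LinearMap.BilinForm ℝ M} {C : Set N} {f : M →ₗ[ℝ] ℝ}

/-- For a simple root `a` in `Q ∩ (-Q)`, `s a` is `a`, `-a` or a `C`-positive root; each is in `Q`.
-/
theorem IsSFit.map_mem (hR : IsEuclideanRootSet B (roots P)) (hQ : IsParabolic P Q)
    (hs : IsRootInvolution P s) (hC : posRoots P C = positiveSet f (roots P))
    (hS : IsSFit P Q s C) {α : M} (hα : α ∈ posRoots P C) (hα' : -α ∈ Q) : s α ∈ Q := by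
  refine map_mem_of_forall_simpleRoots hR hQ hC hS.1.2 hs.map_roots (fun a ha ha' => ?_) hα hα'
  by_cases h1 : s a = a
  · rw [h1]; exact hS.1.2 ha.1
  by_cases h2 : s a = -a
  · rwa [h2]
  exact hS.1.2 (hS.2 a ⟨⟨ha, ha.1.1, h1, h2⟩, fun h => h.2 ha'⟩)

theorem IsVFit.neg_map_mem (hR : IsEuclideanRootSet B (roots P)) (hQ : IsParabolic P Q)
    (hs : IsRootInvolution P s) (hC : posRoots P C = positiveSet f (roots P))
    (hV : IsVFit P Q s C) {α : M} (hα : α ∈ posRoots P C) (hα' : -α ∈ Q) : -s α ∈ Q := by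
  refine map_mem_of_forall_simpleRoots (t := -s) hR hQ hC hV.1.2
    (fun a ha => hR.neg_mem _ (hs.map_roots a ha)) (fun a ha ha' => ?_) hα hα'
  rw [LinearMap.neg_apply]
  by_cases h1 : s a = a
  · rwa [h1]
  by_cases h2 : s a = -a
  · rw [h2, neg_neg]; exact hV.1.2 ha.1
  have h := hV.2 a ⟨⟨ha, ha.1.1, h1, h2⟩, fun h => h.2 ha'⟩
  exact hV.1.2 ⟨hR.neg_mem _ h.1, fun x hx => by simpa using h.2 x hx⟩

theorem sub_mem_closure_of_isLowestRoot (hR : IsEuclideanRootSet B (roots P))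
    (hQ : IsParabolic P Q) {C' : Set N} (hC : IsAdmissible P Q C) (hC' : IsAdmissible P Q C')
    {γ γ' : M} (hγ : IsLowestRoot P C γ) (hγ' : IsLowestRoot P C' γ') :
    γ' - γ ∈ AddSubmonoid.closure {a | a ∈ posRoots P C ∧ -a ∈ Q} := by
  refine mem_closure_inter_neg hR hQ hC.2 (hγ.2 γ' hγ'.1) ?_
  rw [neg_sub]
  exact AddSubmonoid.closure_mono hC'.2 (hγ'.2 γ hγ.1)

end Fit

end ParabolicRoots
end

open ParabolicRoots in
theorem propositionp2p57 {ι M N : Type*} [Finite ι]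
    [AddCommGroup M] [Module ℝ M]
    [AddCommGroup N] [Module ℝ N] [TopologicalSpace N] [IsTopologicalAddGroup N]
    [ContinuousSMul ℝ N] [T2Space N]
    (P : RootPairing ι ℝ M N) [P.IsRootSystem] [P.IsCrystallographic] [P.IsReduced]
    [P.IsIrreducible]
    (Q : Set M) (hQ : IsParabolic P Q)
    (s : M →ₗ[ℝ] M) (hs : IsRootInvolution P s)
    (hnontrivial : ¬ IsTrivialPair P Q) (hfund : IsFundamental P Q s)
    (C_V C_S : Set N) (hV : IsVFit P Q s C_V) (hS : IsSFit P Q s C_S)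
    (C : Set N) (hC : IsAdmissible P Q C) :
    hIndex P Q s (lowestRoot P C_V) ≤ hIndex P Q s (lowestRoot P C) ∧
      hIndex P Q s (lowestRoot P C) ≤ hIndex P Q s (lowestRoot P C_S) := by
  obtain ⟨B, hR, -⟩ := exists_isEuclideanRootSet P
  have lowest {D : Set N} (hD : IsAdmissible P Q D) : IsLowestRoot P D (lowestRoot P D) := by
    obtain ⟨x, hx, hD'⟩ := IsWeylChamber.exists_regular P hD.1
    exact isLowestRoot_lowestRoot P hx hD'
  constructor
  · obtain ⟨x, -, hx⟩ := IsWeylChamber.exists_regular P hV.1.1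
    refine hIndex_le_of_sub_mem_closure hR hQ hs (lowest hC).1 (lowest hV.1).1 ?_
    -- The summands are controlled only for the positive system of `C_V`, so the opposite difference
    -- is decomposed and the signs are reversed.
    rw [← neg_sub]
    refine AddSubmonoid.closure_mono ?_ (neg_mem_closure_neg
      (sub_mem_closure_of_isLowestRoot hR hQ hV.1 hC (lowest hV.1) (lowest hC)))
    rintro a ⟨ha, ha'⟩
    rw [neg_neg] at ha'
    have := hV.neg_map_mem hR hQ hs hx ha (by rwa [neg_neg])
    rw [map_neg, neg_neg] at this
    exact ⟨ha', s a, this, hs.involutive a⟩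
  · obtain ⟨x, -, hx⟩ := IsWeylChamber.exists_regular P hS.1.1
    refine hIndex_le_of_sub_mem_closure hR hQ hs (lowest hS.1).1 (lowest hC).1 ?_
    refine AddSubmonoid.closure_mono ?_
      (sub_mem_closure_of_isLowestRoot hR hQ hS.1 hC (lowest hS.1) (lowest hC))
    rintro a ⟨ha, ha'⟩
    exact ⟨hS.1.2 ha, s a, hS.map_mem hR hQ hs hx ha ha', hs.involutive a⟩
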